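/- Let $k\ge 0$, let $H$ be a subgroup of $\mathbb{Z}^k$, let $G=\mathbb{Z}^k/H$, let $f:\mathbb{Z}^k\to G$ be the quotient map, and let $P=f(\mathbb{N}^k)\subseteq G$ (a finitely generated cancellative abelian monoid). A *$P$-graph* is a countable small category $\Gamma$ with a functor $d:\Gamma\to P$ ($P$ being regarded as a category with one object) such that whenever $d(\xi)=p+q$ there are unique $\eta,\zeta\in\Gamma$ with $d(\eta)=p$, $d(\zeta)=q$ and $\xi=\eta\zeta$. Write $r(\xi)$, $s(\xi)$ for the codomain and domain of a morphism $\xi$, identify objects with their identity morphisms, let $\Gamma^0$ be the set of objects, and let $v\Gamma^p=\{\xi\in\Gamma: r(\xi)=v,\ d(\xi)=p\}$. $\Gamma$ is *row-finite with no sources* if $0<|v\Gamma^p|<\infty$ for all $v\in\Gamma^0$, $p\in P$; then $C^*(\Gamma)$ denotes the universal $C^*$-algebra generated by a family $\{s_\xi:\xi\in\Gamma\}$ such that (CK1) $\{s_v:v\in\Gamma^0\}$ is a set of mutually orthogonal projections; (CK2) $s_\xi s_\eta=s_{\xi\eta}$ whenever $s(\xi)=r(\eta)$; (CK3) $s_\xi^*s_\xi=s_{s(\xi)}$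 for all $\xi\in\Gamma$; (CK4) $s_v=\sum_{\xi\in v\Gamma^p}s_\xi s_\xi^*$ for all $v\in\Gamma^0$ and $p\in P$. The same definitions are used with $\mathbb{N}^k$ in place of $P$. Let $\Gamma$ be a row-finite $P$-graph with no sources, and let $f^*\Gamma=\{(\lambda,n)\in\Gamma\times\mathbb{N}^k: d(\lambda)=f(n)\}$ be the pullback $\mathbb{N}^k$-graph, with $d(\lambda,n)=n$, $r(\lambda,n)=(r(\lambda),0)$, $s(\lambda,n)=(s(\lambda),0)$ and $(\mu,m)(\nu,n)=(\mu\nu,m+n)$; it is again row-finite with no sources. For $z\in\mathbb{T}^k$ and $n\in\mathbb{Z}^k$ put $z^n=\prod_i z_i^{n_i}$, and let $I_z$ be the closed two-sided ideal of $C^*(f^*\Gamma)$ generated by $$\{z^{-n_1}s_{(\lambda,n_1)}-z^{-n_2}s_{(\lambda,n_2)}:\ \lambda\in\Gamma,\ n_1,n_2\in\mathbb{N}^k,\ f(n_1)=f(n_2)=d(\lambda)\}.$$ Then for every $z\in\mathbb{T}^k$ there is an isomorphism of $C^*$-algebras $\psi_z: C^*(f^*\Gamma)/I_z\to C^*(\Gamma)$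 such that $\psi_z(s_{(\lambda,n)}+I_z)=z^n s_\lambda$ for all $(\lambda,n)\in f^*\Gamma$. -/

import Mathlib

universe u v w

noncomputable section

/-! ### The free complex star-algebra on a set of generators -/

/-- Words in the letters `x` and `x*`, for `x : X`; the letter `(x, false)` stands for `x` and
`(x, true)` for `x*`. -/
abbrev StarWord (X : Type u) : Type u := FreeSemigroup (X × Bool)

/-- The adjoint of a word: reverse it and exchange `x` and `x*`. -/
def StarWord.adj {X : Type u} : StarWord X →ₙ* (StarWord X)ᵐᵒᵖ :=
  FreeSemigroup.lift fun a => MulOpposite.op (FreeSemigroup.of (a.1, !a.2))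

instance {X : Type u} : StarMul (StarWord X) where
  star w := (StarWord.adj w).unop
  star_involutive w := by
    induction w using FreeSemigroup.recOnMul with
    | ih1 a => simp [StarWord.adj]
    | ih2 a b ha hb => simp only [map_mul, MulOpposite.unop_mul, ha, hb]
  star_mul a b := by simp

/-- The free non-unital complex star-algebra on `X`: finite linear combinations of words in the
letters `x` and `x*`. -/
def FreeStarAlgebra (X : Type u) : Type u := MonoidAlgebra ℂ (StarWord X)

namespace FreeStarAlgebra

variable {X : Type u}

instance : NonUnitalRing (FreeStarAlgebra X) :=
  inferInstanceAs (NonUnitalRing (MonoidAlgebra ℂ (StarWord X)))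

instance : Module ℂ (FreeStarAlgebra X) :=
  inferInstanceAs (Module ℂ (MonoidAlgebra ℂ (StarWord X)))

instance : IsScalarTower ℂ (FreeStarAlgebra X) (FreeStarAlgebra X) :=
  inferInstanceAs (IsScalarTower ℂ (MonoidAlgebra ℂ (StarWord X)) (MonoidAlgebra ℂ (StarWord X)))

instance : SMulCommClass ℂ (FreeStarAlgebra X) (FreeStarAlgebra X) :=
  inferInstanceAs (SMulCommClass ℂ (MonoidAlgebra ℂ (StarWord X)) (MonoidAlgebra ℂ (StarWord X)))

/-- The scalar multiple `c • w` of a word. -/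
def mono (w : StarWord X) (c : ℂ) : FreeStarAlgebra X := MonoidAlgebra.single w c

/-- The generator `x`. -/
def gen (x : X) : FreeStarAlgebra X := mono (FreeSemigroup.of (x, false)) 1

theorem mono_mul_mono (w₁ w₂ : StarWord X) (c₁ c₂ : ℂ) :
    mono w₁ c₁ * mono w₂ c₂ = mono (w₁ * w₂) (c₁ * c₂) :=
  MonoidAlgebra.single_mul_single _ _ _ _

theorem smul_mono (w : StarWord X) (c d : ℂ) : c • mono w d = mono w (c * d) :=
  MonoidAlgebra.smul_single _ _ _

theorem induction_linear {motive : FreeStarAlgebra X → Prop} (a : FreeStarAlgebra X)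
    (zero : motive 0) (add : ∀ a b, motive a → motive b → motive (a + b))
    (mono : ∀ w c, motive (mono w c)) : motive a :=
  MonoidAlgebra.induction_linear (motive := motive) a zero add mono

/-- The adjoint operation, as an additive map: `(∑ c_w w)* = ∑ conj(c_w) w*`. -/
def adj : FreeStarAlgebra X →+ FreeStarAlgebra X where
  toFun a := MonoidAlgebra.ofCoeff
    (Finsupp.mapDomain star (Finsupp.mapRange (starRingEnd ℂ) (map_zero _) (MonoidAlgebra.coeff a)))
  map_zero' := by
    change MonoidAlgebra.ofCoeff (Finsupp.mapDomain star (Finsupp.mapRange (starRingEnd ℂ)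
      (map_zero _) (0 : StarWord X →₀ ℂ))) = 0
    simp
  map_add' a b := by
    change MonoidAlgebra.ofCoeff (Finsupp.mapDomain star (Finsupp.mapRange (starRingEnd ℂ)
      (map_zero _) (MonoidAlgebra.coeff a + MonoidAlgebra.coeff b))) = _
    rw [Finsupp.mapRange_add (map_add _), Finsupp.mapDomain_add]
    rfl

theorem adj_mono (w : StarWord X) (c : ℂ) : adj (mono w c) = mono (star w) (star c) := by
  change MonoidAlgebra.ofCoeff (Finsupp.mapDomain star (Finsupp.mapRange (starRingEnd ℂ)
      (map_zero _) (Finsupp.single w c))) = _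
  rw [Finsupp.mapRange_single, Finsupp.mapDomain_single]
  rfl

instance : StarRing (FreeStarAlgebra X) where
  star := adj
  star_involutive a := by
    induction a using induction_linear with
    | zero => simp
    | add a b ha hb => simp [ha, hb]
    | mono w c => simp [adj_mono]
  star_mul a b := by
    induction a using induction_linear with
    | zero => simp
    | add a a' ha ha' => simp only [add_mul, mul_add, map_add, ha, ha']
    | mono w c =>
      induction b using induction_linear with
      | zero => simp
      | add b b' hb hb' => simp only [add_mul, mul_add, map_add, hb, hb']
      | mono w' c' => simp only [mono_mul_mono, adj_mono, star_mul]
  star_add := map_add adj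

theorem star_mono (w : StarWord X) (c : ℂ) : star (mono w c) = mono (star w) (star c) :=
  adj_mono w c

instance : StarModule ℂ (FreeStarAlgebra X) where
  star_smul c a := by
    induction a using induction_linear with
    | zero => simp
    | add a b ha hb => simp only [smul_add, star_add, ha, hb]
    | mono w d => simp only [smul_mono, star_mono, star_mul']

/-- Induction along words: every element is obtained from the generators by linear combinations,
products and adjoints. -/
theorem induction_gen {motive : FreeStarAlgebra X → Prop} (a : FreeStarAlgebra X)
    (zero : motive 0) (add : ∀ a b, motive a → motive b → motive (a + b))
    (smul : ∀ (c : ℂ) a, motive a → motive (c • a))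
    (mul : ∀ a b, motive a → motive b → motive (a * b))
    (gen : ∀ x, motive (gen x)) (star_gen : ∀ x, motive (star (FreeStarAlgebra.gen x))) :
    motive a := by
  have hof : ∀ y : X × Bool, motive (mono (FreeSemigroup.of y) 1) := by
    rintro ⟨x, b⟩
    cases b
    · exact gen x
    · have := star_gen x
      rwa [FreeStarAlgebra.gen, star_mono, star_one] at this
  induction a using induction_linear with
  | zero => exact zero
  | add a b ha hb => exact add a b ha hb
  | mono w c =>
    have : motive (mono w 1) := by
      induction w using FreeSemigroup.recOnMul with
      | ih1 y => exact hof y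
      | ih2 y w' _ hw' =>
        have := mul _ _ (hof y) hw'
        rwa [mono_mul_mono, one_mul] at this
    have h := smul c _ this
    rwa [smul_mono, mul_one] at h

/-- The star-homomorphism out of the free star-algebra with prescribed values on the generators. -/
def lift {B : Type v} [NonUnitalRing B] [Module ℂ B] [IsScalarTower ℂ B B] [SMulCommClass ℂ B B]
    [StarRing B] [StarModule ℂ B] (t : X → B) : FreeStarAlgebra X →⋆ₙₐ[ℂ] B :=
  let F : FreeStarAlgebra X →ₙₐ[ℂ] B :=
    MonoidAlgebra.liftMagma ℂ
      (FreeSemigroup.lift fun a : X × Bool => if a.2 then star (t a.1) else t a.1)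
  have hF : ∀ w c, F (mono w c) =
      c • FreeSemigroup.lift (fun a : X × Bool => if a.2 then star (t a.1) else t a.1) w := by
    intro w c
    change (MonoidAlgebra.liftMagma ℂ _ : MonoidAlgebra ℂ (StarWord X) →ₙₐ[ℂ] B)
      (MonoidAlgebra.single w c) = _
    simp
  { F with
    map_star' := fun a => by
      change F (star a) = star (F a)
      induction a using induction_linear with
      | zero => simp
      | add a b ha hb => simp only [map_add, star_add, ha, hb]
      | mono w c =>
        rw [star_mono, hF, hF, star_smul]
        congr 1
        induction w using FreeSemigroup.recOnMul with
        | ih1 y => obtain ⟨x, b⟩ := y; cases b <;> simp [star, StarWord.adj]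
        | ih2 y w' hy hw' => rw [star_mul, map_mul, map_mul, star_mul, hy, hw'] }

theorem lift_gen {B : Type v} [NonUnitalRing B] [Module ℂ B] [IsScalarTower ℂ B B]
    [SMulCommClass ℂ B B] [StarRing B] [StarModule ℂ B] (t : X → B) (x : X) :
    lift t (gen x) = t x := by
  change (MonoidAlgebra.liftMagma ℂ _ : MonoidAlgebra ℂ (StarWord X) →ₙₐ[ℂ] B)
    (MonoidAlgebra.single (FreeSemigroup.of (x, false)) 1) = t x
  simp

end FreeStarAlgebra

/-! ### The universal C*-algebra generated by contractions subject to relations -/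

/-- A C*-seminorm on the free star-algebra for which the generators are contractions and all the
elements of `R` vanish. -/
structure IsAdmissible {X : Type u} (R : Set (FreeStarAlgebra X))
    (p : Seminorm ℂ (FreeStarAlgebra X)) : Prop where
  mul_le : ∀ a b, p (a * b) ≤ p a * p b
  star_mul_self : ∀ a, p (star a * a) = p a * p a
  gen_le : ∀ x, p (FreeStarAlgebra.gen x) ≤ 1
  rel : ∀ a ∈ R, p a = 0

namespace IsAdmissible

variable {X : Type u} {R : Set (FreeStarAlgebra X)} {p : Seminorm ℂ (FreeStarAlgebra X)}

theorem le_star (hp : IsAdmissible R p) (a : FreeStarAlgebra X) : p a ≤ p (star a) := by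
  by_contra! h
  have h1 := hp.star_mul_self a
  have h2 := hp.mul_le (star a) a
  have h3 : 0 ≤ p (star a) := apply_nonneg p _
  nlinarith

theorem star_eq (hp : IsAdmissible R p) (a : FreeStarAlgebra X) : p (star a) = p a :=
  le_antisymm (by simpa using hp.le_star (star a)) (hp.le_star a)

end IsAdmissible

theorem isAdmissible_zero {X : Type u} (R : Set (FreeStarAlgebra X)) :
    IsAdmissible R (0 : Seminorm ℂ (FreeStarAlgebra X)) where
  mul_le := by simp
  star_mul_self := by simp
  gen_le := by simp
  rel := by simp

theorem bddAbove_admissible {X : Type u} (R : Set (FreeStarAlgebra X)) :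
    BddAbove {p | IsAdmissible R p} := by
  have key : ∀ a : FreeStarAlgebra X, ∃ C, ∀ p, IsAdmissible R p → p a ≤ C := by
    intro a
    induction a using FreeStarAlgebra.induction_gen with
    | zero => exact ⟨0, fun p _ => by simp⟩
    | add a b ha hb =>
      obtain ⟨C, hC⟩ := ha
      obtain ⟨D, hD⟩ := hb
      exact ⟨C + D, fun p hp => (map_add_le_add p a b).trans (add_le_add (hC p hp) (hD p hp))⟩
    | smul c a ha =>
      obtain ⟨C, hC⟩ := ha
      refine ⟨‖c‖ * C, fun p hp => ?_⟩
      rw [map_smul_eq_mul]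
      exact mul_le_mul_of_nonneg_left (hC p hp) (norm_nonneg c)
    | mul a b ha hb =>
      obtain ⟨C, hC⟩ := ha
      obtain ⟨D, hD⟩ := hb
      exact ⟨C * D, fun p hp => (hp.mul_le a b).trans
        (mul_le_mul (hC p hp) (hD p hp) (apply_nonneg p b)
          ((apply_nonneg p a).trans (hC p hp)))⟩
    | gen x => exact ⟨1, fun p hp => hp.gen_le x⟩
    | star_gen x => exact ⟨1, fun p hp => (hp.star_eq _).trans_le (hp.gen_le x)⟩
  rw [Seminorm.bddAbove_iff]
  choose C hC using key
  refine ⟨C, ?_⟩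
  rintro _ ⟨p, hp, rfl⟩ a
  exact hC a p hp

/-- The largest admissible C*-seminorm: the supremum of all of them. -/
def universalSeminorm {X : Type u} (R : Set (FreeStarAlgebra X)) :
    Seminorm ℂ (FreeStarAlgebra X) :=
  sSup {p | IsAdmissible R p}

theorem le_universalSeminorm {X : Type u} {R : Set (FreeStarAlgebra X)}
    {p : Seminorm ℂ (FreeStarAlgebra X)} (hp : IsAdmissible R p) (a : FreeStarAlgebra X) :
    p a ≤ universalSeminorm R a :=
  (le_csSup (bddAbove_admissible R) hp : p ≤ universalSeminorm R) a

theorem universalSeminorm_le {X : Type u} {R : Set (FreeStarAlgebra X)} {a : FreeStarAlgebra X}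
    {C : ℝ} (h : ∀ p, IsAdmissible R p → p a ≤ C) : universalSeminorm R a ≤ C := by
  rw [universalSeminorm, Seminorm.sSup_apply (bddAbove_admissible R)]
  have : Nonempty {p | IsAdmissible R p} := ⟨⟨0, isAdmissible_zero R⟩⟩
  exact ciSup_le fun p => h p.1 p.2

theorem isAdmissible_universalSeminorm {X : Type u} (R : Set (FreeStarAlgebra X)) :
    IsAdmissible R (universalSeminorm R) where
  mul_le a b := universalSeminorm_le fun p hp => (hp.mul_le a b).trans
    (mul_le_mul (le_universalSeminorm hp a) (le_universalSeminorm hp b) (apply_nonneg p b)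
      (apply_nonneg _ a))
  star_mul_self a := by
    apply le_antisymm
    · refine universalSeminorm_le fun p hp => ?_
      rw [hp.star_mul_self]
      exact mul_self_le_mul_self (apply_nonneg p a) (le_universalSeminorm hp a)
    · have h0 : 0 ≤ universalSeminorm R (star a * a) := apply_nonneg _ _
      have : universalSeminorm R a ≤ Real.sqrt (universalSeminorm R (star a * a)) := by
        refine universalSeminorm_le fun p hp => Real.le_sqrt_of_sq_le ?_
        rw [sq, ← hp.star_mul_self]
        exact le_universalSeminorm hp _
      calc _ ≤ Real.sqrt (universalSeminorm R (star a * a)) *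
            Real.sqrt (universalSeminorm R (star a * a)) :=
            mul_self_le_mul_self (apply_nonneg _ a) this
        _ = _ := Real.mul_self_sqrt h0
  gen_le x := universalSeminorm_le fun p hp => hp.gen_le x
  rel a ha := le_antisymm (universalSeminorm_le fun p hp => (hp.rel a ha).le) (apply_nonneg _ _)

/-- The free star-algebra, equipped with the universal C*-seminorm for the relations `R`. -/
def PreUniversal {X : Type u} (_R : Set (FreeStarAlgebra X)) : Type u := FreeStarAlgebra X

namespace PreUniversal

variable {X : Type u} (R : Set (FreeStarAlgebra X))

instance : NonUnitalRing (PreUniversal R) := inferInstanceAs (NonUnitalRing (FreeStarAlgebra X))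
instance : StarRing (PreUniversal R) := inferInstanceAs (StarRing (FreeStarAlgebra X))
instance : Module ℂ (PreUniversal R) := inferInstanceAs (Module ℂ (FreeStarAlgebra X))
instance : IsScalarTower ℂ (PreUniversal R) (PreUniversal R) :=
  inferInstanceAs (IsScalarTower ℂ (FreeStarAlgebra X) (FreeStarAlgebra X))
instance : SMulCommClass ℂ (PreUniversal R) (PreUniversal R) :=
  inferInstanceAs (SMulCommClass ℂ (FreeStarAlgebra X) (FreeStarAlgebra X))
instance : StarModule ℂ (PreUniversal R) := inferInstanceAs (StarModule ℂ (FreeStarAlgebra X))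

instance : SeminormedAddCommGroup (PreUniversal R) :=
  AddGroupSeminorm.toSeminormedAddCommGroup (universalSeminorm R).toAddGroupSeminorm

theorem norm_def (a : PreUniversal R) : ‖a‖ = universalSeminorm R a := rfl

instance : NonUnitalSeminormedRing (PreUniversal R) where
  __ := (inferInstance : SeminormedAddCommGroup (PreUniversal R))
  __ := (inferInstance : NonUnitalRing (PreUniversal R))
  norm_mul_le := (isAdmissible_universalSeminorm R).mul_le

instance : NormedSpace ℂ (PreUniversal R) where
  norm_smul_le c a := (map_smul_eq_mul (universalSeminorm R) c a).le

instance : NormedStarGroup (PreUniversal R) where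
  norm_star_le a := ((isAdmissible_universalSeminorm R).star_eq a).le

theorem norm_star_mul_self (a : PreUniversal R) : ‖star a * a‖ = ‖a‖ * ‖a‖ :=
  (isAdmissible_universalSeminorm R).star_mul_self a

end PreUniversal

open UniformSpace in
/-- The Hausdorff completion of the free star-algebra in the universal C*-seminorm. -/
def UniversalCompletion {X : Type u} (R : Set (FreeStarAlgebra X)) : Type u :=
  Completion (PreUniversal R)

namespace UniversalCompletion

open UniformSpace

variable {X : Type u} (R : Set (FreeStarAlgebra X))

instance : NormedAddCommGroup (UniversalCompletion R) :=
  inferInstanceAs (NormedAddCommGroup (Completion (PreUniversal R)))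
instance : NormedSpace ℂ (UniversalCompletion R) :=
  inferInstanceAs (NormedSpace ℂ (Completion (PreUniversal R)))
instance : CompleteSpace (UniversalCompletion R) :=
  inferInstanceAs (CompleteSpace (Completion (PreUniversal R)))

/-- The canonical map from the free star-algebra. -/
def ofFree (a : FreeStarAlgebra X) : UniversalCompletion R :=
  ((show PreUniversal R from a : PreUniversal R) : Completion (PreUniversal R))

variable {R}

theorem isDenseInducing_ofFree :
    IsDenseInducing (fun a : PreUniversal R => ofFree R a) := Completion.isDenseInducing_coe

theorem continuous_ofFree : Continuous (fun a : PreUniversal R => ofFree R a) :=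
  Completion.continuous_coe _

theorem norm_ofFree (a : FreeStarAlgebra X) : ‖ofFree R a‖ = universalSeminorm R a :=
  Completion.norm_coe (E := PreUniversal R) a

theorem ofFree_add (a b : FreeStarAlgebra X) : ofFree R (a + b) = ofFree R a + ofFree R b :=
  Completion.coe_add (α := PreUniversal R) a b

theorem ofFree_zero : ofFree R 0 = 0 := rfl

theorem ofFree_smul (c : ℂ) (a : FreeStarAlgebra X) : ofFree R (c • a) = c • ofFree R a :=
  Completion.coe_smul (X := PreUniversal R) c a

theorem induction_on {motive : UniversalCompletion R → Prop} (a : UniversalCompletion R)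
    (hp : IsClosed {a | motive a}) (ih : ∀ a, motive (ofFree R a)) : motive a :=
  Completion.induction_on (α := PreUniversal R) a hp ih

theorem induction_on₂ {motive : UniversalCompletion R → UniversalCompletion R → Prop}
    (a b : UniversalCompletion R)
    (hp : IsClosed {x : UniversalCompletion R × UniversalCompletion R | motive x.1 x.2})
    (ih : ∀ a b, motive (ofFree R a) (ofFree R b)) : motive a b :=
  Completion.induction_on₂ (α := PreUniversal R) (β := PreUniversal R) a b hp ih

theorem induction_on₃ {motive : UniversalCompletion R → UniversalCompletion R →
      UniversalCompletion R → Prop} (a b c : UniversalCompletion R)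
    (hp : IsClosed {x : UniversalCompletion R × UniversalCompletion R ×
      UniversalCompletion R | motive x.1 x.2.1 x.2.2})
    (ih : ∀ a b c, motive (ofFree R a) (ofFree R b) (ofFree R c)) : motive a b c :=
  Completion.induction_on₃ (α := PreUniversal R) (β := PreUniversal R) (γ := PreUniversal R)
    a b c hp ih

/-- The product, extended by continuity from the free star-algebra. -/
instance : Mul (UniversalCompletion R) where
  mul := Function.curry <| (isDenseInducing_ofFree.prodMap isDenseInducing_ofFree).extend
    (fun q : PreUniversal R × PreUniversal R => ofFree R (q.1 * q.2))

theorem ofFree_mul (a b : FreeStarAlgebra X) : ofFree R (a * b) = ofFree R a * ofFree R b :=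
  ((isDenseInducing_ofFree.prodMap isDenseInducing_ofFree).extend_eq
    (f := fun q : PreUniversal R × PreUniversal R => ofFree R (q.1 * q.2))
    (continuous_ofFree.comp continuous_mul) (a, b)).symm

instance : ContinuousMul (UniversalCompletion R) where
  continuous_mul := by
    let m := (AddMonoidHom.mul : PreUniversal R →+ PreUniversal R →+ PreUniversal R).compr₂
      Completion.toCompl
    have hm : Continuous fun p : PreUniversal R × PreUniversal R => m p.1 p.2 :=
      (Completion.continuous_coe _).comp continuous_mul
    have di : IsDenseInducing (Completion.toCompl : PreUniversal R → Completion (PreUniversal R)) :=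
      Completion.isDenseInducing_coe
    exact (di.extend_Z_bilin di hm :)

theorem continuous_const_smul' (c : ℂ) : Continuous fun a : UniversalCompletion R => c • a :=
  continuous_const_smul c

theorem smul_mul_assoc' (c : ℂ) (a b : UniversalCompletion R) : (c • a) * b = c • (a * b) := by
  induction a, b using induction_on₂ with
  | hp =>
    exact isClosed_eq (((continuous_const_smul' c).comp continuous_fst).mul continuous_snd)
      ((continuous_const_smul' c).comp (continuous_fst.mul continuous_snd))
  | ih a b => simp only [← ofFree_smul, ← ofFree_mul, smul_mul_assoc]

theorem mul_smul_comm' (c : ℂ) (a b : UniversalCompletion R) : c • (a * b) = a * (c • b) := by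
  induction a, b using induction_on₂ with
  | hp =>
    exact isClosed_eq ((continuous_const_smul' c).comp (continuous_fst.mul continuous_snd))
      (continuous_fst.mul ((continuous_const_smul' c).comp continuous_snd))
  | ih a b => simp only [← ofFree_smul, ← ofFree_mul, mul_smul_comm]

/-- The adjoint operation, extended by continuity from the free star-algebra. -/
instance : Star (UniversalCompletion R) where
  star := Completion.map (star : PreUniversal R → PreUniversal R)

theorem uniformContinuous_star_pre : UniformContinuous (star : PreUniversal R → PreUniversal R) :=
  (AddMonoidHomClass.isometry_of_norm (starAddEquiv : PreUniversal R ≃+ PreUniversal R)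
    fun a => norm_star a).uniformContinuous

theorem ofFree_star (a : FreeStarAlgebra X) : ofFree R (star a) = star (ofFree R a) :=
  (Completion.map_coe (α := PreUniversal R) (β := PreUniversal R) uniformContinuous_star_pre a).symm

instance : ContinuousStar (UniversalCompletion R) where
  continuous_star := Completion.continuous_map

theorem star_smul' (c : ℂ) (a : UniversalCompletion R) : star (c • a) = star c • star a := by
  induction a using induction_on with
  | hp =>
    exact isClosed_eq (continuous_star.comp (continuous_const_smul' c))
      ((continuous_const_smul' (star c)).comp continuous_star)
  | ih a => simp only [← ofFree_star, ← ofFree_smul, star_smul]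

instance : NonUnitalRing (UniversalCompletion R) where
  toAddCommGroup := inferInstance
  mul := (· * ·)
  zero_mul a := by
    induction a using induction_on with
    | hp => exact isClosed_eq (by fun_prop) (by fun_prop)
    | ih a =>
      rw [← ofFree_zero, ← ofFree_mul, zero_mul]
  mul_zero a := by
    induction a using induction_on with
    | hp => exact isClosed_eq (by fun_prop) (by fun_prop)
    | ih a =>
      rw [← ofFree_zero, ← ofFree_mul, mul_zero]
  mul_assoc a b c := by
    induction a, b, c using induction_on₃ with
    | hp => exact isClosed_eq (by fun_prop) (by fun_prop)
    | ih a b c =>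
      simp only [← ofFree_mul, mul_assoc]
  left_distrib a b c := by
    induction a, b, c using induction_on₃ with
    | hp => exact isClosed_eq (by fun_prop) (by fun_prop)
    | ih a b c =>
      simp only [← ofFree_mul, ← ofFree_add, mul_add]
  right_distrib a b c := by
    induction a, b, c using induction_on₃ with
    | hp => exact isClosed_eq (by fun_prop) (by fun_prop)
    | ih a b c =>
      simp only [← ofFree_mul, ← ofFree_add, add_mul]

instance : NonUnitalNormedRing (UniversalCompletion R) where
  toNorm := inferInstance
  toNonUnitalRing := inferInstance
  toMetricSpace := inferInstance
  dist_eq := NormedAddCommGroup.dist_eq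
  norm_mul_le a b := by
    induction a, b using induction_on₂ with
    | hp =>
      exact isClosed_le (f := fun x : UniversalCompletion R × UniversalCompletion R =>
        ‖x.1 * x.2‖) (g := fun x => ‖x.1‖ * ‖x.2‖) (by fun_prop) (by fun_prop)
    | ih a b =>
      rw [← ofFree_mul, norm_ofFree, norm_ofFree, norm_ofFree]
      exact (isAdmissible_universalSeminorm R).mul_le a b

instance : IsScalarTower ℂ (UniversalCompletion R) (UniversalCompletion R) where
  smul_assoc := smul_mul_assoc'

instance : SMulCommClass ℂ (UniversalCompletion R) (UniversalCompletion R) where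
  smul_comm := mul_smul_comm'

instance : StarRing (UniversalCompletion R) where
  star_involutive a := by
    induction a using induction_on with
    | hp => exact isClosed_eq (by fun_prop) (by fun_prop)
    | ih a =>
      simp only [← ofFree_star, star_star]
  star_mul a b := by
    induction a, b using induction_on₂ with
    | hp => exact isClosed_eq (by fun_prop) (by fun_prop)
    | ih a b =>
      simp only [← ofFree_star, ← ofFree_mul, star_mul]
  star_add a b := by
    induction a, b using induction_on₂ with
    | hp => exact isClosed_eq (by fun_prop) (by fun_prop)
    | ih a b =>
      simp only [← ofFree_star, ← ofFree_add, star_add]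

instance : StarModule ℂ (UniversalCompletion R) where
  star_smul := star_smul'

instance : CStarRing (UniversalCompletion R) where
  norm_mul_self_le a := by
    induction a using induction_on with
    | hp => exact isClosed_le (by fun_prop) (by fun_prop)
    | ih a =>
      rw [← ofFree_star, ← ofFree_mul, norm_ofFree, norm_ofFree]
      exact ((isAdmissible_universalSeminorm R).star_mul_self a).ge

instance : NonUnitalCStarAlgebra (UniversalCompletion R) where

variable (R) in
/-- The canonical generators. -/
def gen (x : X) : UniversalCompletion R := ofFree R (FreeStarAlgebra.gen x)

/-- The canonical map from the free star-algebra, as a star-homomorphism. -/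
def ofFreeHom : FreeStarAlgebra X →⋆ₙₐ[ℂ] UniversalCompletion R where
  toFun := ofFree R
  map_smul' := ofFree_smul
  map_zero' := ofFree_zero
  map_add' := ofFree_add
  map_mul' := ofFree_mul
  map_star' := ofFree_star

theorem ofFree_rel {a : FreeStarAlgebra X} (ha : a ∈ R) : ofFree R a = 0 := by
  rw [← norm_eq_zero, norm_ofFree]
  exact (isAdmissible_universalSeminorm R).rel a ha

theorem existsUnique_hom {B : Type v} [NonUnitalCStarAlgebra B] (t : X → B)
    (ht : ∀ x, ‖t x‖ ≤ 1) (hR : ∀ a ∈ R, FreeStarAlgebra.lift t a = 0) :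
    ∃! φ : UniversalCompletion R →⋆ₙₐ[ℂ] B, ∀ x, φ (gen R x) = t x := by
  let F := FreeStarAlgebra.lift t
  let p : Seminorm ℂ (FreeStarAlgebra X) :=
    (normSeminorm ℂ B).comp (F : FreeStarAlgebra X →ₗ[ℂ] B)
  have hpF : ∀ a, p a = ‖F a‖ := fun a => rfl
  have hp : IsAdmissible R p :=
    { mul_le := fun a b => by simpa only [hpF, map_mul] using norm_mul_le _ _
      star_mul_self := fun a => by
        simpa only [hpF, map_mul, map_star] using CStarRing.norm_star_mul_self
      gen_le := fun x => by
        rw [hpF, FreeStarAlgebra.lift_gen]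
        exact ht x
      rel := fun a ha => by rw [hpF, hR a ha, norm_zero] }
  have hunif : UniformContinuous (fun a : PreUniversal R => F a) :=
    AddMonoidHomClass.uniformContinuous_of_bound
      (show PreUniversal R →+ B from (F : FreeStarAlgebra X →+ B)) 1
      fun a => by
        rw [one_mul]
        exact le_universalSeminorm hp a
  let E : UniversalCompletion R → B := Completion.extension (fun a : PreUniversal R => F a)
  have hEc : Continuous E := Completion.continuous_extension
  have hE : ∀ a, E (ofFree R a) = F a := fun a => Completion.extension_coe hunif a
  refine ⟨{ toFun := E
            map_smul' := fun c a => ?_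
            map_zero' := ?_
            map_add' := fun a b => ?_
            map_mul' := fun a b => ?_
            map_star' := fun a => ?_ }, ?_, ?_⟩
  · induction a using induction_on with
    | hp => exact isClosed_eq (hEc.comp (continuous_const_smul' c)) (hEc.const_smul c)
    | ih a =>
      simp only [MonoidHom.id_apply, ← ofFree_smul, hE, map_smul]
  · change E 0 = 0
    rw [← ofFree_zero, hE, map_zero]
  · induction a, b using induction_on₂ with
    | hp => exact isClosed_eq (by fun_prop) (by fun_prop)
    | ih a b =>
      simp only [← ofFree_add, hE, map_add]
  · induction a, b using induction_on₂ with
    | hp => exact isClosed_eq (by fun_prop) (by fun_prop)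
    | ih a b =>
      simp only [← ofFree_mul, hE, map_mul]
  · induction a using induction_on with
    | hp => exact isClosed_eq (by fun_prop) (by fun_prop)
    | ih a =>
      simp only [← ofFree_star, hE, map_star]
  · exact fun x => (hE _).trans (FreeStarAlgebra.lift_gen t x)
  · intro φ hφ
    have hφc : Continuous φ :=
      AddMonoidHomClass.continuous_of_bound φ 1 fun a => by
        simpa using NonUnitalStarAlgHom.norm_apply_le φ a
    ext a
    change φ a = E a
    refine induction_on (motive := fun a => φ a = E a) a (isClosed_eq hφc hEc) fun a => ?_
    rw [hE]
    induction a using FreeStarAlgebra.induction_gen with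
    | zero => simp [ofFree_zero]
    | add a b ha hb => rw [ofFree_add, map_add, map_add, ha, hb]
    | smul c a ha => rw [ofFree_smul, map_smul, map_smul, ha]
    | mul a b ha hb => rw [ofFree_mul, map_mul, map_mul, ha, hb]
    | gen x => exact (hφ x).trans (FreeStarAlgebra.lift_gen t x).symm
    | star_gen x =>
      rw [ofFree_star, map_star, map_star]
      exact congrArg star ((hφ x).trans (FreeStarAlgebra.lift_gen t x).symm)

end UniversalCompletion

/-- The universal C*-algebra generated by contractions indexed by `X` and subject to the relations
`a = 0` for `a ∈ R`: the Hausdorff completion of the free star-algebra in the universal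
C*-seminorm. -/
def UniversalCStarAlgebra {X : Type u} (R : Set (FreeStarAlgebra X)) : Type u :=
  UniversalCompletion R

namespace UniversalCStarAlgebra

variable {X : Type u} (R : Set (FreeStarAlgebra X))

/-- The C*-algebra structure (made irreducible below, which only serves efficiency). -/
instance cstarStructure : NonUnitalCStarAlgebra (UniversalCStarAlgebra R) :=
  inferInstanceAs (NonUnitalCStarAlgebra (UniversalCompletion R))

/-- The canonical map from the free star-algebra. -/
def ofFree : FreeStarAlgebra X →⋆ₙₐ[ℂ] UniversalCStarAlgebra R :=
  UniversalCompletion.ofFreeHom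

/-- The canonical generators. -/
def gen (x : X) : UniversalCStarAlgebra R := ofFree R (FreeStarAlgebra.gen x)

theorem norm_ofFree (a : FreeStarAlgebra X) : ‖ofFree R a‖ = universalSeminorm R a :=
  UniversalCompletion.norm_ofFree a

theorem denseRange_ofFree : DenseRange (ofFree R) :=
  UniversalCompletion.isDenseInducing_ofFree.dense

variable {R} in
theorem ofFree_rel {a : FreeStarAlgebra X} (ha : a ∈ R) : ofFree R a = 0 :=
  UniversalCompletion.ofFree_rel ha

variable {R} in
/-- The universal property: contractions in a C*-algebra that satisfy the relations are the images
of the canonical generators under exactly one star-homomorphism. -/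
theorem existsUnique_hom {B : Type v} [NonUnitalCStarAlgebra B] (t : X → B)
    (ht : ∀ x, ‖t x‖ ≤ 1) (hR : ∀ a ∈ R, FreeStarAlgebra.lift t a = 0) :
    ∃! φ : UniversalCStarAlgebra R →⋆ₙₐ[ℂ] B, ∀ x, φ (gen R x) = t x :=
  UniversalCompletion.existsUnique_hom t ht hR

attribute [irreducible] cstarStructure

end UniversalCStarAlgebra

/-! ### Ideals of C*-algebras and their quotients -/

/-- An ideal of a C*-algebra: a closed two-sided ideal. -/
structure CStarIdeal (A : Type u) [NonUnitalCStarAlgebra A] extends Submodule ℂ A where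
  mul_mem_left' : ∀ (a : A) {x : A}, x ∈ carrier → a * x ∈ carrier
  mul_mem_right' : ∀ (a : A) {x : A}, x ∈ carrier → x * a ∈ carrier
  isClosed' : IsClosed carrier

namespace CStarIdeal

variable {A : Type u} [NonUnitalCStarAlgebra A]

instance : SetLike (CStarIdeal A) A where
  coe I := I.carrier
  coe_injective I J h := by
    obtain ⟨I, _, _, _⟩ := I
    obtain ⟨J, _, _, _⟩ := J
    congr
    exact SetLike.coe_injective h

instance : AddSubgroupClass (CStarIdeal A) A where
  add_mem {I} _ _ ha hb := I.toSubmodule.add_mem ha hb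
  zero_mem I := I.toSubmodule.zero_mem
  neg_mem {I} _ ha := I.toSubmodule.neg_mem ha

variable (I : CStarIdeal A)

theorem mem_toSubmodule {a : A} : a ∈ I.toSubmodule ↔ a ∈ I := Iff.rfl

theorem smul_mem (c : ℂ) {x : A} (hx : x ∈ I) : c • x ∈ I := I.toSubmodule.smul_mem c hx

theorem mul_mem_left (a : A) {x : A} (hx : x ∈ I) : a * x ∈ I := I.mul_mem_left' a hx

theorem mul_mem_right (a : A) {x : A} (hx : x ∈ I) : x * a ∈ I := I.mul_mem_right' a hx

theorem isClosed : IsClosed (I : Set A) := I.isClosed'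

/-- The ideal generated by a set: the intersection of all the ideals that contain it. -/
def span (S : Set A) : CStarIdeal A where
  carrier := {x | ∀ J : CStarIdeal A, S ⊆ (J : Set A) → x ∈ J}
  add_mem' ha hb J hJ := add_mem (ha J hJ) (hb J hJ)
  zero_mem' J _ := zero_mem J
  smul_mem' c _ hx J hJ := J.smul_mem c (hx J hJ)
  mul_mem_left' a _ hx J hJ := J.mul_mem_left a (hx J hJ)
  mul_mem_right' a _ hx J hJ := J.mul_mem_right a (hx J hJ)
  isClosed' := by
    have : {x : A | ∀ J : CStarIdeal A, S ⊆ (J : Set A) → x ∈ J} =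
        ⋂ (J : CStarIdeal A) (_ : S ⊆ (J : Set A)), (J : Set A) := by
      ext x
      simp
    rw [this]
    exact isClosed_iInter fun J => isClosed_iInter fun _ => J.isClosed

theorem subset_span (S : Set A) : S ⊆ (span S : Set A) := fun _ hx _ hJ => hJ hx

theorem span_le {S : Set A} {J : CStarIdeal A} (h : S ⊆ (J : Set A)) :
    (span S : Set A) ⊆ (J : Set A) := fun _ hx => hx J h

/-- The self-adjoint part `I ∩ I*`, a C*-subalgebra. -/
def starCore : NonUnitalStarSubalgebra ℂ A where
  carrier := {x | x ∈ I ∧ star x ∈ I}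
  add_mem' ha hb := ⟨add_mem ha.1 hb.1, by rw [star_add]; exact add_mem ha.2 hb.2⟩
  zero_mem' := ⟨zero_mem I, by rw [star_zero]; exact zero_mem I⟩
  mul_mem' {a b} ha hb := ⟨I.mul_mem_right b ha.1, by
    rw [star_mul]
    exact I.mul_mem_right _ hb.2⟩
  smul_mem' c _ ha := ⟨I.smul_mem c ha.1, by
    rw [star_smul]
    exact I.smul_mem _ ha.2⟩
  star_mem' ha := ⟨ha.2, by rw [star_star]; exact ha.1⟩

theorem isClosed_starCore : IsClosed (I.starCore : Set A) :=
  I.isClosed.inter (I.isClosed.preimage continuous_star)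

open CStarAlgebra in
/-- Local approximate units: for `y ∈ I ∩ I*` there is a positive contraction in the ideal that
almost fixes `y`. -/
theorem exists_approx_core {y : A} (hy : y ∈ I) (hy' : star y ∈ I) {ε : ℝ} (hε : 0 < ε) :
    ∃ b : A, star b * b ∈ I ∧ ‖star b * b‖ ≤ 1 ∧ ‖y - y * (star b * b)‖ < ε := by
  have : IsClosed (I.starCore : Set A) := I.isClosed_starCore
  let B := I.starCore
  let _ : PartialOrder B := CStarAlgebra.spectralOrder B
  have : StarOrderedRing B := CStarAlgebra.spectralOrderedRing B
  have hl := CStarAlgebra.increasingApproximateUnit B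
  let y' : B := ⟨y, hy, hy'⟩
  have h1 : ∀ᶠ e in CStarAlgebra.approximateUnit B, dist (y' * e) y' < ε :=
    (hl.tendsto_mul_left y').eventually (Metric.ball_mem_nhds y' hε)
  obtain ⟨e, he1, he2, he3⟩ := (h1.and (hl.eventually_nonneg.and hl.eventually_norm)).exists
  obtain ⟨b, hb⟩ := CStarAlgebra.nonneg_iff_eq_star_mul_self.mp he2
  have hb' : (e : A) = star (b : A) * (b : A) := congrArg Subtype.val hb
  refine ⟨(b : A), ?_, ?_, ?_⟩
  · rw [← hb']
    exact e.2.1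
  · rw [← hb']
    exact he3
  · rw [← hb', norm_sub_rev]
    rw [dist_eq_norm] at he1
    exact he1

theorem norm_sub_mul_le (a b : A) (hb : ‖star b * b‖ ≤ 1) : ‖a - a * (star b * b)‖ ≤ ‖a‖ := by
  let _ : PartialOrder (Unitization ℂ A) := CStarAlgebra.spectralOrder _
  have : StarOrderedRing (Unitization ℂ A) := CStarAlgebra.spectralOrderedRing _
  set e : Unitization ℂ A := ((star b * b : A) : Unitization ℂ A) with he
  have he0 : 0 ≤ e := by
    rw [he, Unitization.inr_mul, Unitization.inr_star]
    exact star_mul_self_nonneg _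
  have he1 : e ≤ 1 := by
    rw [← CStarAlgebra.norm_le_one_iff_of_nonneg e he0, he, Unitization.norm_inr]
    exact hb
  have h2 : ‖1 - e‖ ≤ 1 := by
    rw [CStarAlgebra.norm_le_one_iff_of_nonneg (1 - e) (sub_nonneg.mpr he1)]
    exact sub_le_self 1 he0
  calc ‖a - a * (star b * b)‖ = ‖(a : Unitization ℂ A) * (1 - e)‖ := by
        rw [← Unitization.norm_inr (𝕜 := ℂ), Unitization.inr_sub, Unitization.inr_mul, he, mul_sub,
          mul_one]
    _ ≤ ‖(a : Unitization ℂ A)‖ * ‖1 - e‖ := norm_mul_le _ _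
    _ ≤ ‖(a : Unitization ℂ A)‖ * 1 := by gcongr
    _ = ‖a‖ := by rw [mul_one, Unitization.norm_inr]

/-- Local approximate units for arbitrary elements of the ideal. -/
theorem exists_approx {x : A} (hx : x ∈ I) {ε : ℝ} (hε : 0 < ε) :
    ∃ b : A, star b * b ∈ I ∧ ‖star b * b‖ ≤ 1 ∧ ‖x - x * (star b * b)‖ < ε := by
  have hy : star x * x ∈ I := I.mul_mem_left _ hx
  obtain ⟨b, hb1, hb2, hb3⟩ := I.exists_approx_core hy (by simpa using hy)
    (show 0 < ε * ε / 2 by positivity)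
  refine ⟨b, hb1, hb2, ?_⟩
  set e := star b * b with he
  have hes : star e = e := by simp [he]
  have h1 : star (x - x * e) * (x - x * e) =
      (star x * x - star x * x * e) - e * (star x * x - star x * x * e) := by
    rw [star_sub, star_mul, hes]
    noncomm_ring
  have h2 : ‖x - x * e‖ * ‖x - x * e‖ < ε * ε := by
    rw [← CStarRing.norm_star_mul_self, h1]
    calc _ ≤ ‖star x * x - star x * x * e‖ + ‖e‖ * ‖star x * x - star x * x * e‖ :=
          (norm_sub_le _ _).trans (add_le_add le_rfl (norm_mul_le _ _))
      _ ≤ ‖star x * x - star x * x * e‖ + 1 * ‖star x * x - star x * x * e‖ := by gcongr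
      _ < ε * ε := by linarith
  exact lt_of_mul_self_lt_mul_self₀ hε.le h2

/-- Ideals of C*-algebras are self-adjoint. -/
theorem star_mem {x : A} (hx : x ∈ I) : star x ∈ I := by
  have : star x ∈ closure (I : Set A) := by
    rw [Metric.mem_closure_iff]
    intro ε hε
    obtain ⟨b, hb1, -, hb3⟩ := I.exists_approx hx hε
    refine ⟨star (x * (star b * b)), ?_, ?_⟩
    · rw [star_mul]
      have : star (star b * b) = star b * b := by simp
      rw [this]
      exact I.mul_mem_right _ hb1
    · rw [dist_eq_norm, ← star_sub, norm_star]
      exact hb3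
  rwa [I.isClosed.closure_eq] at this

theorem star_mem_iff {x : A} : star x ∈ I ↔ x ∈ I :=
  ⟨fun h => by simpa using I.star_mem h, I.star_mem⟩

instance : IsClosed (I.toSubmodule : Set A) := I.isClosed'

/-- The underlying Banach space of the quotient `A/I`, with the quotient norm. -/
def PreQuotient : Type u := A ⧸ I.toSubmodule

namespace PreQuotient

instance : NormedAddCommGroup I.PreQuotient :=
  inferInstanceAs (NormedAddCommGroup (A ⧸ I.toSubmodule))
instance : NormedSpace ℂ I.PreQuotient := inferInstanceAs (NormedSpace ℂ (A ⧸ I.toSubmodule))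
instance : CompleteSpace I.PreQuotient := inferInstanceAs (CompleteSpace (A ⧸ I.toSubmodule))

/-- The class of an element. -/
def mk (a : A) : I.PreQuotient := Submodule.Quotient.mk (p := I.toSubmodule) a

variable {I}

theorem mk_eq_mk {a b : A} : mk I a = mk I b ↔ a - b ∈ I :=
  Submodule.Quotient.eq (p := I.toSubmodule)

theorem mk_surjective : Function.Surjective (mk I) := Submodule.Quotient.mk_surjective _

theorem mk_add (a b : A) : mk I (a + b) = mk I a + mk I b := rfl
theorem mk_zero : mk I 0 = 0 := rfl
theorem mk_smul (c : ℂ) (a : A) : mk I (c • a) = c • mk I a := rfl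

theorem norm_mk (a : A) : ‖mk I a‖ = Metric.infDist a I := QuotientAddGroup.norm_mk a

theorem norm_mk_lt_iff (a : A) (r : ℝ) : ‖mk I a‖ < r ↔ ∃ x ∈ I, ‖a + x‖ < r := by
  rw [norm_mk, Metric.infDist_lt_iff ⟨0, zero_mem I⟩]
  constructor
  · rintro ⟨x, hx, h⟩
    exact ⟨-x, neg_mem hx, by rwa [dist_eq_norm, sub_eq_add_neg] at h⟩
  · rintro ⟨x, hx, h⟩
    exact ⟨-x, neg_mem hx, by rwa [dist_eq_norm, sub_neg_eq_add]⟩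

theorem norm_mk_le (a : A) : ‖mk I a‖ ≤ ‖a‖ := by
  refine le_of_forall_gt fun r hr => ?_
  exact (norm_mk_lt_iff a r).mpr ⟨0, zero_mem I, by simpa using hr⟩

instance : Mul I.PreQuotient where
  mul := _root_.Quotient.map₂ (fun a b => a * b) fun a a' h b b' h' => by
    have h1 : a - a' ∈ I := mk_eq_mk.mp (_root_.Quotient.sound h)
    have h2 : b - b' ∈ I := mk_eq_mk.mp (_root_.Quotient.sound h')
    refine _root_.Quotient.exact (mk_eq_mk.mpr ?_ : mk I (a * b) = mk I (a' * b'))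
    have : a * b - a' * b' = (a - a') * b + a' * (b - b') := by noncomm_ring
    rw [this]
    exact add_mem (I.mul_mem_right _ h1) (I.mul_mem_left _ h2)

theorem mk_mul (a b : A) : mk I (a * b) = mk I a * mk I b := rfl

instance : Star I.PreQuotient where
  star := _root_.Quotient.map (fun a => star a) fun a a' h => by
    have h1 : a - a' ∈ I := mk_eq_mk.mp (_root_.Quotient.sound h)
    refine _root_.Quotient.exact (mk_eq_mk.mpr ?_ : mk I (star a) = mk I (star a'))
    rw [← star_sub]
    exact I.star_mem h1

theorem mk_star (a : A) : mk I (star a) = star (mk I a) := rfl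

instance : NonUnitalRing I.PreQuotient where
  toAddCommGroup := inferInstance
  mul := (· * ·)
  zero_mul a := by
    obtain ⟨a, rfl⟩ := mk_surjective a
    rw [← mk_zero, ← mk_mul, zero_mul]
  mul_zero a := by
    obtain ⟨a, rfl⟩ := mk_surjective a
    rw [← mk_zero, ← mk_mul, mul_zero]
  mul_assoc a b c := by
    obtain ⟨a, rfl⟩ := mk_surjective a
    obtain ⟨b, rfl⟩ := mk_surjective b
    obtain ⟨c, rfl⟩ := mk_surjective c
    simp only [← mk_mul, mul_assoc]
  left_distrib a b c := by
    obtain ⟨a, rfl⟩ := mk_surjective a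
    obtain ⟨b, rfl⟩ := mk_surjective b
    obtain ⟨c, rfl⟩ := mk_surjective c
    simp only [← mk_mul, ← mk_add, mul_add]
  right_distrib a b c := by
    obtain ⟨a, rfl⟩ := mk_surjective a
    obtain ⟨b, rfl⟩ := mk_surjective b
    obtain ⟨c, rfl⟩ := mk_surjective c
    simp only [← mk_mul, ← mk_add, add_mul]

theorem norm_mul_le' (a b : I.PreQuotient) : ‖a * b‖ ≤ ‖a‖ * ‖b‖ := by
  obtain ⟨a, rfl⟩ := mk_surjective a
  obtain ⟨b, rfl⟩ := mk_surjective b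
  have key : ∀ r > ‖mk I a‖, ∀ s > ‖mk I b‖, ‖mk I a * mk I b‖ ≤ r * s := by
    intro r hr s hs
    obtain ⟨x, hx, hxr⟩ := (norm_mk_lt_iff a r).mp hr
    obtain ⟨y, hy, hys⟩ := (norm_mk_lt_iff b s).mp hs
    have ha : mk I a = mk I (a + x) := mk_eq_mk.mpr (by simpa using neg_mem hx)
    have hb : mk I b = mk I (b + y) := mk_eq_mk.mpr (by simpa using neg_mem hy)
    rw [ha, hb, ← mk_mul]
    calc _ ≤ ‖(a + x) * (b + y)‖ := norm_mk_le _
      _ ≤ ‖a + x‖ * ‖b + y‖ := norm_mul_le _ _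
      _ ≤ r * s := mul_le_mul hxr.le hys.le (norm_nonneg _) ((norm_nonneg _).trans hxr.le)
  refine le_of_forall_pos_le_add fun ε hε => ?_
  have hc : ContinuousAt (fun t : ℝ => (‖mk I a‖ + t) * (‖mk I b‖ + t)) 0 := by fun_prop
  have hlim : Filter.Tendsto (fun t : ℝ => (‖mk I a‖ + t) * (‖mk I b‖ + t))
      (nhdsWithin 0 (Set.Ioi 0)) (nhds (‖mk I a‖ * ‖mk I b‖)) := by
    simpa using hc.tendsto.mono_left nhdsWithin_le_nhds
  have : ‖mk I a * mk I b‖ ≤ ‖mk I a‖ * ‖mk I b‖ := by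
    refine ge_of_tendsto hlim ?_
    filter_upwards [self_mem_nhdsWithin] with t ht
    have ht' : 0 < t := ht
    exact key _ (by linarith) _ (by linarith)
  linarith

instance : NonUnitalNormedRing I.PreQuotient where
  toNorm := inferInstance
  toNonUnitalRing := inferInstance
  toMetricSpace := inferInstance
  dist_eq := NormedAddCommGroup.dist_eq
  norm_mul_le := norm_mul_le'

instance : IsScalarTower ℂ I.PreQuotient I.PreQuotient where
  smul_assoc c a b := by
    obtain ⟨a, rfl⟩ := mk_surjective a
    obtain ⟨b, rfl⟩ := mk_surjective b
    simp only [smul_eq_mul, ← mk_smul, ← mk_mul, smul_mul_assoc]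

instance : SMulCommClass ℂ I.PreQuotient I.PreQuotient where
  smul_comm c a b := by
    obtain ⟨a, rfl⟩ := mk_surjective a
    obtain ⟨b, rfl⟩ := mk_surjective b
    simp only [smul_eq_mul, ← mk_smul, ← mk_mul, mul_smul_comm]

instance : StarRing I.PreQuotient where
  star_involutive a := by
    obtain ⟨a, rfl⟩ := mk_surjective a
    rw [← mk_star, ← mk_star, star_star]
  star_mul a b := by
    obtain ⟨a, rfl⟩ := mk_surjective a
    obtain ⟨b, rfl⟩ := mk_surjective b
    rw [← mk_mul, ← mk_star, star_mul, mk_mul, mk_star, mk_star]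
  star_add a b := by
    obtain ⟨a, rfl⟩ := mk_surjective a
    obtain ⟨b, rfl⟩ := mk_surjective b
    rw [← mk_add, ← mk_star, star_add, mk_add, mk_star, mk_star]

instance : StarModule ℂ I.PreQuotient where
  star_smul c a := by
    obtain ⟨a, rfl⟩ := mk_surjective a
    rw [← mk_smul, ← mk_star, star_smul, mk_smul, mk_star]

instance : CStarRing I.PreQuotient where
  norm_mul_self_le a := by
    obtain ⟨a, rfl⟩ := mk_surjective a
    rw [← mk_star, ← mk_mul]
    refine le_of_forall_gt fun r hr => ?_
    obtain ⟨x, hx, hxr⟩ := (norm_mk_lt_iff _ r).mp hr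
    obtain ⟨b, hb1, hb2, hb3⟩ := I.exists_approx hx (sub_pos.mpr hxr)
    set e := star b * b with he
    have hes : star e = e := by simp [he]
    have h1 : ‖mk I a‖ ≤ ‖a - a * e‖ := by
      have : mk I a = mk I (a - a * e) := mk_eq_mk.mpr (by simpa using I.mul_mem_left a hb1)
      rw [this]
      exact norm_mk_le _
    have h2 : star (a - a * e) * (a - a * e) =
        (star a * a - star a * a * e) - e * (star a * a - star a * a * e) := by
      rw [star_sub, star_mul, hes]
      noncomm_ring
    set c := star a * a - star a * a * e with hc
    have h3 : ‖c - e * c‖ ≤ ‖c‖ := by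
      have := norm_sub_mul_le (star c) b hb2
      rwa [← he, ← norm_star, star_sub, star_star, star_mul, star_star, hes, norm_star] at this
    have h4 : c = ((star a * a + x) - (star a * a + x) * e) - (x - x * e) := by
      rw [hc]
      noncomm_ring
    calc ‖mk I a‖ * ‖mk I a‖ ≤ ‖a - a * e‖ * ‖a - a * e‖ :=
          mul_self_le_mul_self (norm_nonneg _) h1
      _ = ‖c - e * c‖ := by rw [← CStarRing.norm_star_mul_self, h2]
      _ ≤ ‖c‖ := h3
      _ ≤ ‖(star a * a + x) - (star a * a + x) * e‖ + ‖x - x * e‖ := by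
          rw [h4]
          exact norm_sub_le _ _
      _ < ‖star a * a + x‖ + (r - ‖star a * a + x‖) :=
          add_lt_add_of_le_of_lt (norm_sub_mul_le _ b hb2) hb3
      _ = r := by ring

instance : NonUnitalCStarAlgebra I.PreQuotient where

end PreQuotient

/-- The quotient C*-algebra `A/I`, with the operations induced from `A` and the quotient norm. -/
def Quotient : Type u := I.PreQuotient

namespace Quotient

/-- The C*-algebra structure (made irreducible below, which only serves efficiency). -/
instance cstarStructure : NonUnitalCStarAlgebra I.Quotient :=
  inferInstanceAs (NonUnitalCStarAlgebra I.PreQuotient)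

/-- The quotient map `a ↦ a + I`. -/
def mk : A →⋆ₙₐ[ℂ] I.Quotient where
  toFun := PreQuotient.mk I
  map_smul' := PreQuotient.mk_smul
  map_zero' := PreQuotient.mk_zero
  map_add' := PreQuotient.mk_add
  map_mul' := PreQuotient.mk_mul
  map_star' := PreQuotient.mk_star

variable {I}

theorem mk_eq_mk {a b : A} : mk I a = mk I b ↔ a - b ∈ I := PreQuotient.mk_eq_mk

theorem mk_surjective : Function.Surjective (mk I) := PreQuotient.mk_surjective

theorem norm_mk (a : A) : ‖mk I a‖ = Metric.infDist a I := PreQuotient.norm_mk a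

attribute [irreducible] cstarStructure

theorem mk_eq_zero {a : A} : mk I a = 0 ↔ a ∈ I := by
  rw [← map_zero (mk I), mk_eq_mk, sub_zero]

end Quotient

end CStarIdeal

/-! ### `P`-graphs, pullbacks and their C*-algebras -/

open CategoryTheory

/-- A `P`-graph: a countable small category `Γ` with a functor `d : Γ → P` (the monoid `P` being
regarded as a category with one object) which has the factorisation property. The range of
`ξ : a ⟶ b` is `b`, its source is `a`, and the composite of paths `ηζ` is `ζ ≫ η`. The monoids used
below are `ℕ^k` and its images in quotients of `ℤ^k`, which are finitely generated and
cancellative. -/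
structure PGraph (P : Type w) [AddCommMonoid P] where
  /-- The objects (vertices). -/
  Obj : Type u
  /-- The category structure; its morphisms are the elements of the `P`-graph. -/
  [category : Category.{v} Obj]
  countable : Countable (Σ a b : Obj, a ⟶ b)
  /-- The degree functor. -/
  deg : ∀ {a b : Obj}, (a ⟶ b) → P
  deg_id : ∀ a : Obj, deg (𝟙 a) = 0
  deg_comp : ∀ {a b c : Obj} (ζ : a ⟶ b) (η : b ⟶ c), deg (ζ ≫ η) = deg η + deg ζ
  /-- If `d(ξ) = p + q`, then `ξ = ηζ` for unique `η`, `ζ` with `d(η) = p` and `d(ζ) = q`. -/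
  factor : ∀ {a b : Obj} (ξ : a ⟶ b) (p q : P), deg ξ = p + q →
    ∃! x : Σ c : Obj, (a ⟶ c) × (c ⟶ b), deg x.2.2 = p ∧ deg x.2.1 = q ∧ x.2.1 ≫ x.2.2 = ξ

namespace PGraph

attribute [instance] PGraph.category

section Basic

variable {P : Type w} [AddCommMonoid P] (Γ : PGraph.{u, v, w} P)

/-- All the morphisms of `Γ`. -/
abbrev Mor : Type (max u v) := Σ a b : Γ.Obj, a ⟶ b

/-- The set `vΓ^p` of the morphisms with range `v` and degree `p`. -/
abbrev PathsTo (v : Γ.Obj) (p : P) : Type (max u v) :=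
  {ξ : Σ a : Γ.Obj, a ⟶ v // Γ.deg ξ.2 = p}

/-- `Γ` is row-finite with no sources: `0 < |vΓ^p| < ∞` for every vertex `v` and every `p ∈ P`. -/
class RowFiniteNoSources : Prop where
  finite : ∀ (v : Γ.Obj) (p : P), Finite (Γ.PathsTo v p)
  nonempty : ∀ (v : Γ.Obj) (p : P), Nonempty (Γ.PathsTo v p)

attribute [instance] RowFiniteNoSources.finite

/-- A Cuntz-Krieger `Γ`-family. -/
structure IsCuntzKriegerFamily [Γ.RowFiniteNoSources] {B : Type*} [NonUnitalRing B] [StarRing B]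
    (t : ∀ {a b : Γ.Obj}, (a ⟶ b) → B) : Prop where
  projection : ∀ v : Γ.Obj, IsStarProjection (t (𝟙 v))
  orthogonal : ∀ v w : Γ.Obj, v ≠ w → t (𝟙 v) * t (𝟙 w) = 0
  mul : ∀ {a b c : Γ.Obj} (ζ : a ⟶ b) (η : b ⟶ c), t η * t ζ = t (ζ ≫ η)
  star_mul_self : ∀ {a b : Γ.Obj} (ξ : a ⟶ b), star (t ξ) * t ξ = t (𝟙 a)
  sum_eq : ∀ (v : Γ.Obj) (p : P), t (𝟙 v) = ∑ᶠ ξ : Γ.PathsTo v p, t ξ.1.2 * star (t ξ.1.2)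

/-- The generator of the free star-algebra on the morphisms of `Γ` given by `ξ`. -/
def freeGen {a b : Γ.Obj} (ξ : a ⟶ b) : FreeStarAlgebra Γ.Mor := FreeStarAlgebra.gen ⟨a, b, ξ⟩

/-- The Cuntz-Krieger relations, as elements of the free star-algebra that have to vanish. -/
inductive CuntzKriegerRelation [Γ.RowFiniteNoSources] : FreeStarAlgebra Γ.Mor → Prop
  | idempotent (v : Γ.Obj) :
      CuntzKriegerRelation (Γ.freeGen (𝟙 v) * Γ.freeGen (𝟙 v) - Γ.freeGen (𝟙 v))
  | selfAdjoint (v : Γ.Obj) :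
      CuntzKriegerRelation (star (Γ.freeGen (𝟙 v)) - Γ.freeGen (𝟙 v))
  | orthogonal (v w : Γ.Obj) (h : v ≠ w) :
      CuntzKriegerRelation (Γ.freeGen (𝟙 v) * Γ.freeGen (𝟙 w))
  | mul {a b c : Γ.Obj} (ζ : a ⟶ b) (η : b ⟶ c) :
      CuntzKriegerRelation (Γ.freeGen η * Γ.freeGen ζ - Γ.freeGen (ζ ≫ η))
  | star_mul_self {a b : Γ.Obj} (ξ : a ⟶ b) :
      CuntzKriegerRelation (star (Γ.freeGen ξ) * Γ.freeGen ξ - Γ.freeGen (𝟙 a))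
  | sum_eq (v : Γ.Obj) (p : P) :
      CuntzKriegerRelation (Γ.freeGen (𝟙 v) -
        ∑ᶠ ξ : Γ.PathsTo v p, Γ.freeGen ξ.1.2 * star (Γ.freeGen ξ.1.2))

/-- The C*-algebra `C*(Γ)` of a row-finite `P`-graph with no sources: the universal C*-algebra
generated by a Cuntz-Krieger `Γ`-family. (The elements of such a family are automatically
contractions.) -/
def CStar [Γ.RowFiniteNoSources] : Type (max u v) :=
  UniversalCStarAlgebra {a : FreeStarAlgebra Γ.Mor | Γ.CuntzKriegerRelation a}

instance [Γ.RowFiniteNoSources] : NonUnitalCStarAlgebra Γ.CStar :=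
  inferInstanceAs (NonUnitalCStarAlgebra (UniversalCStarAlgebra _))

/-- The canonical generator `s_ξ` of `C*(Γ)`. -/
def s [Γ.RowFiniteNoSources] {a b : Γ.Obj} (ξ : a ⟶ b) : Γ.CStar :=
  UniversalCStarAlgebra.gen {a : FreeStarAlgebra Γ.Mor | Γ.CuntzKriegerRelation a} ⟨a, b, ξ⟩

theorem isCuntzKriegerFamily_s [Γ.RowFiniteNoSources] : Γ.IsCuntzKriegerFamily Γ.s := by
  let q : FreeStarAlgebra Γ.Mor →⋆ₙₐ[ℂ] Γ.CStar :=
    UniversalCStarAlgebra.ofFree {a : FreeStarAlgebra Γ.Mor | Γ.CuntzKriegerRelation a}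
  have hq : ∀ a, Γ.CuntzKriegerRelation a → q a = 0 := fun a ha =>
    UniversalCStarAlgebra.ofFree_rel ha
  have hs : ∀ {a b : Γ.Obj} (ξ : a ⟶ b), Γ.s ξ = q (Γ.freeGen ξ) := fun ξ => rfl
  refine ⟨fun v => ⟨?_, ?_⟩, fun v w h => ?_, fun ζ η => ?_, fun ξ => ?_, fun v p => ?_⟩
  · have := hq _ (.idempotent v)
    rwa [map_sub, map_mul, sub_eq_zero] at this
  · have := hq _ (.selfAdjoint v)
    rwa [map_sub, map_star, sub_eq_zero] at this
  · have := hq _ (.orthogonal v w h)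
    rwa [map_mul] at this
  · have := hq _ (.mul ζ η)
    rwa [map_sub, map_mul, sub_eq_zero] at this
  · have := hq _ (.star_mul_self ξ)
    rwa [map_sub, map_mul, map_star, sub_eq_zero] at this
  · have := hq _ (.sum_eq v p)
    rw [map_sub, sub_eq_zero] at this
    rw [hs, this, map_finsum q (Set.toFinite _)]
    exact finsum_congr fun ξ => by rw [map_mul, map_star, hs]

theorem IsCuntzKriegerFamily.norm_le_one [Γ.RowFiniteNoSources] {B : Type*}
    [NonUnitalCStarAlgebra B] {t : ∀ {a b : Γ.Obj}, (a ⟶ b) → B}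
    (ht : Γ.IsCuntzKriegerFamily t) {a b : Γ.Obj} (ξ : a ⟶ b) : ‖t ξ‖ ≤ 1 := by
  have h1 : ‖t (𝟙 a)‖ ≤ 1 := by
    have h : ‖t (𝟙 a)‖ * ‖t (𝟙 a)‖ = ‖t (𝟙 a)‖ := by
      rw [← CStarRing.norm_star_mul_self, ht.star_mul_self]
    nlinarith [norm_nonneg (t (𝟙 a))]
  have h2 : ‖t ξ‖ * ‖t ξ‖ ≤ 1 := by
    rw [← CStarRing.norm_star_mul_self, ht.star_mul_self]
    exact h1
  nlinarith [norm_nonneg (t ξ)]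

/-- The universal property of `C*(Γ)`. -/
theorem existsUnique_hom [Γ.RowFiniteNoSources] {B : Type*} [NonUnitalCStarAlgebra B]
    (t : ∀ {a b : Γ.Obj}, (a ⟶ b) → B) (ht : Γ.IsCuntzKriegerFamily t) :
    ∃! φ : Γ.CStar →⋆ₙₐ[ℂ] B, ∀ {a b : Γ.Obj} (ξ : a ⟶ b), φ (Γ.s ξ) = t ξ := by
  have hl : ∀ {a b : Γ.Obj} (ξ : a ⟶ b),
      FreeStarAlgebra.lift (fun x : Γ.Mor => t x.2.2) (Γ.freeGen ξ) = t ξ := fun ξ =>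
    FreeStarAlgebra.lift_gen _ _
  have key := UniversalCStarAlgebra.existsUnique_hom
    (R := {a : FreeStarAlgebra Γ.Mor | Γ.CuntzKriegerRelation a})
    (fun x : Γ.Mor => t x.2.2) (fun x => ht.norm_le_one Γ x.2.2) (by
      rintro _ (v | v | ⟨v, w, h⟩ | ⟨ζ, η⟩ | ξ | ⟨v, p⟩)
      · rw [map_sub, map_mul, hl, (ht.projection v).isIdempotentElem.eq, sub_self]
      · rw [map_sub, map_star, hl, (ht.projection v).isSelfAdjoint.star_eq, sub_self]
      · rw [map_mul, hl, hl, ht.orthogonal v w h]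
      · rw [map_sub, map_mul, hl, hl, hl, ht.mul, sub_self]
      · rw [map_sub, map_mul, map_star, hl, hl, ht.star_mul_self, sub_self]
      · rw [map_sub, hl, ht.sum_eq v p, sub_eq_zero, map_finsum _ (Set.toFinite _)]
        exact finsum_congr fun ξ => by rw [map_mul, map_star, hl])
  obtain ⟨φ, h1, h2⟩ := key
  exact ⟨φ, fun ξ => h1 ⟨_, _, ξ⟩, fun ψ hψ => h2 ψ fun x => hψ x.2.2⟩

end Basic

section Pullback

variable {P : Type w} [AddCommMonoid P] {Q : Type*} [AddCommMonoid Q]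
  (Γ : PGraph.{u, v, w} P) (f : Q →+ P)

/-- The objects of the pullback: those of `Γ`. -/
@[ext]
structure PullbackObj (_f : Q →+ P) where
  /-- The underlying object of `Γ`. -/
  obj : Γ.Obj

/-- The morphisms of the pullback: pairs `(ξ, n)` with `d(ξ) = f(n)`. -/
@[ext]
structure PullbackHom (a b : Γ.Obj) where
  /-- The path in `Γ`. -/
  path : a ⟶ b
  /-- The degree of the pair. -/
  val : Q
  deg_eq : Γ.deg path = f val

instance : Category (Γ.PullbackObj f) where
  Hom a b := Γ.PullbackHom f a.obj b.obj
  id a := ⟨𝟙 a.obj, 0, by rw [Γ.deg_id, map_zero]⟩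
  comp ζ η := ⟨ζ.path ≫ η.path, η.val + ζ.val, by
    rw [Γ.deg_comp, map_add, η.deg_eq, ζ.deg_eq]⟩
  id_comp ζ := PullbackHom.ext (Category.id_comp ζ.path) (add_zero _)
  comp_id ζ := PullbackHom.ext (Category.comp_id ζ.path) (zero_add _)
  assoc α β γ := PullbackHom.ext (Category.assoc α.path β.path γ.path) (add_assoc _ _ _).symm

/-- The pullback `Q`-graph `f*Γ = {(ξ, n) : d(ξ) = f(n)}`, with `d(ξ, n) = n`. -/
def pullback [Countable Q] : PGraph Q where
  Obj := Γ.PullbackObj f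
  countable := by
    have := Γ.countable
    let F : (Σ a b : Γ.PullbackObj f, a ⟶ b) → Γ.Mor × Q :=
      fun x => (⟨x.1.obj, x.2.1.obj, PullbackHom.path x.2.2⟩, PullbackHom.val x.2.2)
    refine Function.Injective.countable (f := F) ?_
    rintro ⟨⟨a⟩, ⟨b⟩, ξ, n, h⟩ ⟨⟨a'⟩, ⟨b'⟩, ξ', n', h'⟩ hF
    simp only [F, Prod.mk.injEq] at hF
    obtain ⟨h1, h2⟩ := hF
    cases h1
    cases h2
    rfl
  deg ξ := PullbackHom.val ξ
  deg_id _ := rfl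
  deg_comp _ _ := rfl
  factor := by
    rintro ⟨a⟩ ⟨b⟩ ⟨ξ, n, h⟩ p q (rfl : n = p + q)
    obtain ⟨⟨c, ζ, η⟩, ⟨h1, h2, h3⟩, hu⟩ := Γ.factor ξ (f p) (f q) (by rw [h, map_add])
    refine ⟨⟨⟨c⟩, ⟨ζ, q, h2⟩, ⟨η, p, h1⟩⟩, ⟨rfl, rfl, PullbackHom.ext h3 rfl⟩, ?_⟩
    rintro ⟨⟨c'⟩, ⟨ζ', q', h2'⟩, ⟨η', p', h1'⟩⟩ ⟨hp, hq, hc⟩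
    change p' = p at hp
    change q' = q at hq
    subst hp hq
    have := hu ⟨c', ζ', η'⟩ ⟨h1', h2', congrArg PullbackHom.path hc⟩
    cases this
    rfl

instance [Countable Q] [Γ.RowFiniteNoSources] : (Γ.pullback f).RowFiniteNoSources where
  finite := by
    rintro ⟨v⟩ n
    let F : (Γ.pullback f).PathsTo ⟨v⟩ n → Γ.PathsTo v (f n) :=
      fun x => ⟨⟨x.1.1.obj, PullbackHom.path x.1.2⟩,
        (PullbackHom.deg_eq x.1.2).trans (congrArg f x.2)⟩
    refine Finite.of_injective F ?_
    rintro ⟨⟨⟨a⟩, ξ, m, h⟩, hm⟩ ⟨⟨⟨a'⟩, ξ', m', h'⟩, hm'⟩ hF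
    change m = n at hm
    change m' = n at hm'
    subst hm hm'
    simp only [F, Subtype.mk.injEq] at hF
    cases hF
    rfl
  nonempty := by
    rintro ⟨v⟩ n
    obtain ⟨⟨⟨a, ξ⟩, h⟩⟩ := RowFiniteNoSources.nonempty (Γ := Γ) v (f n)
    exact ⟨⟨⟨⟨a⟩, (⟨ξ, n, h⟩ : Γ.PullbackHom f a v)⟩, rfl⟩⟩

/-- The morphism `(ξ, n)` of `f*Γ`, for `ξ ∈ Γ` and `n ∈ Q` with `d(ξ) = f(n)`. -/
def pair [Countable Q] {a b : Γ.Obj} (ξ : a ⟶ b) (n : Q) (h : Γ.deg ξ = f n) :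
    (⟨a⟩ : Γ.PullbackObj f) ⟶ ⟨b⟩ :=
  ⟨ξ, n, h⟩

/-- The generator `s_{(ξ, n)}` of `C*(f*Γ)`, for `ξ ∈ Γ` and `n ∈ Q` with `d(ξ) = f(n)`. -/
def sPullback [Countable Q] [Γ.RowFiniteNoSources] {a b : Γ.Obj} (ξ : a ⟶ b) (n : Q)
    (h : Γ.deg ξ = f n) : (Γ.pullback f).CStar :=
  (Γ.pullback f).s (Γ.pair f ξ n h)

end Pullback

end PGraph

/-! ### The setting of the theorem -/

/-- The map `ℕ^k → ℤ^k/H` obtained by restricting the quotient map `ℤ^k → ℤ^k/H`. -/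
def quotientOnNat {k : ℕ} (H : AddSubgroup (Fin k → ℤ)) :
    (Fin k → ℕ) →+ (Fin k → ℤ) ⧸ H :=
  (QuotientAddGroup.mk' H).comp ((Nat.castAddMonoidHom ℤ).compLeft (Fin k))

/-- The image `P` of `ℕ^k` in `ℤ^k/H`. -/
abbrev imageMonoid {k : ℕ} (H : AddSubgroup (Fin k → ℤ)) : AddSubmonoid ((Fin k → ℤ) ⧸ H) :=
  AddMonoidHom.mrange (quotientOnNat H)

/-- The quotient map `ℤ^k → ℤ^k/H`, restricted to a homomorphism `f : ℕ^k → P`. -/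
def degreeMap {k : ℕ} (H : AddSubgroup (Fin k → ℤ)) : (Fin k → ℕ) →+ imageMonoid H :=
  (quotientOnNat H).mrangeRestrict

/-- The monomial `z^n = z₁^{n₁} ⋯ z_k^{n_k}`, for `z` in the torus `𝕋^k` and `n ∈ ℕ^k`. -/
def torusPow {k : ℕ} (z : Fin k → Circle) (n : Fin k → ℕ) : Circle := ∏ i, z i ^ n i

/-- The ideal `I_z` of `C*(f*Γ)` generated by the elements
`z^{-n₁} s_{(ξ, n₁)} - z^{-n₂} s_{(ξ, n₂)}`, for `ξ ∈ Γ` and `f(n₁) = f(n₂) = d(ξ)`. -/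
def pullbackIdeal {k : ℕ} (H : AddSubgroup (Fin k → ℤ)) (Γ : PGraph.{u, v, 0} (imageMonoid H))
    [Γ.RowFiniteNoSources] (z : Fin k → Circle) :
    CStarIdeal (Γ.pullback (degreeMap H)).CStar :=
  CStarIdeal.span {x | ∃ (a b : Γ.Obj) (ξ : a ⟶ b) (n₁ n₂ : Fin k → ℕ)
    (h₁ : Γ.deg ξ = degreeMap H n₁) (h₂ : Γ.deg ξ = degreeMap H n₂),
    x = (((torusPow z n₁)⁻¹ : Circle) : ℂ) • Γ.sPullback (degreeMap H) ξ n₁ h₁ -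
      (((torusPow z n₂)⁻¹ : Circle) : ℂ) • Γ.sPullback (degreeMap H) ξ n₂ h₂}

end

/-! Both algebras have the same universal property. The generators of $I_z$ say exactly that, modulo
$I_z$, the element $z^{-n}s_{(\lambda,n)}$ depends on $\lambda$ alone. A homomorphism out of
$C^*(f^*\Gamma)/I_z$ is therefore a Cuntz-Krieger family $t$ of $f^*\Gamma$ for which
$u_\lambda=z^{-n}t_{(\lambda,n)}$ is independent of the lift $n$ of $d(\lambda)$. The assignments
$t_{(\lambda,n)}=z^n u_\lambda$ and $u_\lambda=z^{-n}t_{(\lambda,n)}$ match such families with the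
Cuntz-Krieger families of $\Gamma$.

The two directions are `IsCuntzKriegerFamily.twist` and `IsCuntzKriegerFamily.untwist`, stated for a
homomorphism $f:Q\to P$ of commutative monoids (surjective for the descent) and a circle-valued
character $\omega$ of $Q$. The relations survive for three reasons: $\omega$ is multiplicative,
which gives (CK2); $|\omega|=1$, so scalars cancel in $s^*s$ and $ss^*$; and
$(\lambda,n)\mapsto\lambda$ is a bijection from paths of degree $n$ in $f^*\Gamma$ onto paths of
degree $f(n)$ in $\Gamma$, which matches the sums in (CK4).

Twisting the generators of $C^*(\Gamma)$ gives `φ`, which kills $I_z$ and so factors as `ψ` through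
the quotient. Untwisting the images of the generators of $C^*(f^*\Gamma)$ in the quotient gives `χ`
in the other direction. The uniqueness halves of the universal properties show that `ψ` and `χ` are
mutually inverse, so injectivity of `ψ` needs no separate uniqueness theorem. -/

namespace CStarIdeal

/-! ### Kernels and factorisation through quotient C*-algebras -/

variable {A : Type u} [NonUnitalCStarAlgebra A] {B : Type v} [NonUnitalCStarAlgebra B]

/-- The kernel of a star-homomorphism between C*-algebras. -/
def ker (φ : A →⋆ₙₐ[ℂ] B) : CStarIdeal A where
  carrier := {x | φ x = 0}
  add_mem' {a b} ha hb := by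
    rw [Set.mem_ofPred_eq] at *
    rw [map_add, ha, hb, add_zero]
  zero_mem' := map_zero φ
  smul_mem' c x hx := by
    rw [Set.mem_ofPred_eq] at *
    rw [map_smul, hx, smul_zero]
  mul_mem_left' a x hx := by
    rw [Set.mem_ofPred_eq] at *
    rw [map_mul, hx, mul_zero]
  mul_mem_right' a x hx := by
    rw [Set.mem_ofPred_eq] at *
    rw [map_mul, hx, zero_mul]
  isClosed' := by
    -- Star-homomorphisms between C*-algebras are automatically contractive.
    have hφ : Continuous φ := AddMonoidHomClass.continuous_of_bound φ 1 fun a => by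
      simpa using NonUnitalStarAlgHom.norm_apply_le φ a
    exact isClosed_eq hφ continuous_const

/-- A star-homomorphism that vanishes on an ideal factors through the quotient. -/
theorem Quotient.exists_lift {I : CStarIdeal A} (φ : A →⋆ₙₐ[ℂ] B) (h : ∀ x ∈ I, φ x = 0) :
    ∃ ψ : I.Quotient →⋆ₙₐ[ℂ] B, ∀ a, ψ (Quotient.mk I a) = φ a := by
  -- A class is evaluated at an arbitrarily chosen representative. Since `φ` vanishes on `I`, the
  -- choice does not matter (`hg`), and every algebraic identity can be checked on classes of
  -- elements of `A`.
  let g := Function.surjInv (Quotient.mk_surjective (I := I))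
  have hg : ∀ a, φ (g (Quotient.mk I a)) = φ a := fun a => by
    rw [← sub_eq_zero, ← map_sub]
    exact h _ (Quotient.mk_eq_mk.mp (Function.surjInv_eq Quotient.mk_surjective _))
  refine ⟨{ toFun := fun q => φ (g q)
            map_smul' := fun c q => ?_
            map_zero' := ?_
            map_add' := fun q q' => ?_
            map_mul' := fun q q' => ?_
            map_star' := fun q => ?_ }, hg⟩
  · obtain ⟨a, rfl⟩ := Quotient.mk_surjective q
    simp only [← map_smul, hg, MonoidHom.id_apply]
  -- The representative `g 0` need not be `0`; it is only some element of `I`.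
  · change φ (g 0) = 0
    rw [← map_zero (Quotient.mk I), hg, map_zero]
  · obtain ⟨a, rfl⟩ := Quotient.mk_surjective q
    obtain ⟨b, rfl⟩ := Quotient.mk_surjective q'
    simp only [← map_add, hg]
  · obtain ⟨a, rfl⟩ := Quotient.mk_surjective q
    obtain ⟨b, rfl⟩ := Quotient.mk_surjective q'
    simp only [← map_mul, hg]
  · obtain ⟨a, rfl⟩ := Quotient.mk_surjective q
    simp only [← map_star, hg]

end CStarIdeal

/-! ### Passing Cuntz-Krieger families between a graph and its pullback -/

namespace PGraph

open CategoryTheory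

/-- The relations are identities between star-polynomials; the sum in (CK4) is finite by
row-finiteness, so it commutes with `φ`. This is applied to the quotient map by $I_z$. -/
theorem IsCuntzKriegerFamily.map {P : Type w} [AddCommMonoid P] {Γ : PGraph.{u, v, w} P}
    [Γ.RowFiniteNoSources] {A B : Type*} [NonUnitalCStarAlgebra A] [NonUnitalCStarAlgebra B]
    {t : ∀ {a b : Γ.Obj}, (a ⟶ b) → A} (ht : Γ.IsCuntzKriegerFamily t) (φ : A →⋆ₙₐ[ℂ] B) :
    Γ.IsCuntzKriegerFamily (fun {a b} (ξ : a ⟶ b) => φ (t ξ)) where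
  projection v := (ht.projection v).map φ
  orthogonal v w h := by rw [← map_mul, ht.orthogonal v w h, map_zero]
  mul ζ η := by rw [← map_mul, ht.mul]
  star_mul_self ξ := by rw [← map_star, ← map_mul, ht.star_mul_self]
  sum_eq v p := by
    rw [ht.sum_eq v p, map_finsum φ (Set.toFinite _)]
    exact finsum_congr fun ξ => by rw [map_mul, map_star]

section Pullback

variable {P : Type w} [AddCommMonoid P] {Q : Type*} [AddCommMonoid Q] [Countable Q]
  (Γ : PGraph.{u, v, w} P) (f : Q →+ P)

/-- The paths of degree `n` in the pullback correspond to the paths of degree `f(n)` in `Γ`. -/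
def pathsToEquiv (x : Γ.Obj) (n : Q) : Γ.PathsTo x (f n) ≃ (Γ.pullback f).PathsTo ⟨x⟩ n where
  toFun ξ := ⟨⟨⟨ξ.1.1⟩, Γ.pair f ξ.1.2 n ξ.2⟩, rfl⟩
  invFun ξ := ⟨⟨ξ.1.1.obj, PullbackHom.path ξ.1.2⟩,
    (PullbackHom.deg_eq ξ.1.2).trans (congrArg f ξ.2)⟩
  left_inv _ := rfl
  right_inv := by
    -- The degree `m` stored in the morphism equals `n` only by hypothesis; after the substitution
    -- both sides agree definitionally.
    rintro ⟨⟨⟨a⟩, ξ, m, h⟩, rfl⟩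
    rfl

variable {Γ f} [Γ.RowFiniteNoSources] {B : Type*} [NonUnitalCStarAlgebra B]

/-- The inverse of a unimodular scalar is its conjugate, so twisting leaves the range projections in
(CK4) unchanged. The companion below does the same for the source projections in (CK3). -/
theorem circle_smul_mul_star (c : Circle) (x : B) :
    ((c : ℂ) • x) * star ((c : ℂ) • x) = x * star x := by
  have hc : (c : ℂ) * star (c : ℂ) = 1 := by
    rw [Complex.star_def, ← Circle.coe_inv_eq_conj, ← Circle.coe_mul, mul_inv_cancel,
      Circle.coe_one]
  rw [star_smul, smul_mul_smul_comm, hc, one_smul]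

theorem circle_star_mul_smul (c : Circle) (x : B) :
    star ((c : ℂ) • x) * ((c : ℂ) • x) = star x * x := by
  have hc : star (c : ℂ) * (c : ℂ) = 1 := by
    rw [Complex.star_def, ← Circle.coe_inv_eq_conj, ← Circle.coe_mul, inv_mul_cancel,
      Circle.coe_one]
  rw [star_smul, smul_mul_smul_comm, hc, one_smul]

/-- Multiplying a Cuntz-Krieger family of `Γ` by a character gives one of the pullback. -/
theorem IsCuntzKriegerFamily.twist {t : ∀ {a b : Γ.Obj}, (a ⟶ b) → B}
    (ht : Γ.IsCuntzKriegerFamily t) (ω : Multiplicative Q →* Circle) :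
    (Γ.pullback f).IsCuntzKriegerFamily (fun {a b} (ξ : a ⟶ b) =>
      ((ω (.ofAdd (PullbackHom.val ξ)) : Circle) : ℂ) • t (PullbackHom.path ξ)) := by
  -- Identities of the pullback have degree `0`, where a character takes the value `1`: the vertex
  -- projections are not twisted.
  have h1 : ∀ x : (Γ.pullback f).Obj,
      ((ω (.ofAdd (PullbackHom.val (𝟙 x))) : Circle) : ℂ) • t (PullbackHom.path (𝟙 x)) =
        t (𝟙 x.obj) := by
    intro x
    change ((ω (.ofAdd (0 : Q)) : Circle) : ℂ) • t (𝟙 x.obj) = _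
    rw [ofAdd_zero, map_one, Circle.coe_one, one_smul]
  refine ⟨fun x => ?_, fun x y h => ?_, fun ζ η => ?_, fun ξ => ?_, fun x n => ?_⟩
  · rw [h1]
    exact ht.projection _
  · rw [h1, h1]
    exact ht.orthogonal _ _ fun h' => h (PullbackObj.ext h')
  · change _ = ((ω (.ofAdd (PullbackHom.val η + PullbackHom.val ζ)) : Circle) : ℂ) •
      t (PullbackHom.path ζ ≫ PullbackHom.path η)
    rw [smul_mul_smul_comm, ht.mul, ofAdd_add, map_mul, Circle.coe_mul]
  · rw [h1, circle_star_mul_smul, ht.star_mul_self]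
  -- (CK4) for the pullback at `n` is (CK4) for `Γ` at `f n`. All the paths in the sum have degree
  -- `n`, so the common scalar `ω(n)` cancels in each term, and the sum is then reindexed along
  -- `pathsToEquiv`.
  · rw [h1, ht.sum_eq _ (f n)]
    let g : (Γ.pullback f).PathsTo x n → B := fun ξ =>
      (((ω (.ofAdd (PullbackHom.val ξ.1.2)) : Circle) : ℂ) • t (PullbackHom.path ξ.1.2)) *
        star (((ω (.ofAdd (PullbackHom.val ξ.1.2)) : Circle) : ℂ) • t (PullbackHom.path ξ.1.2))
    exact (finsum_congr fun ξ => (circle_smul_mul_star (ω (.ofAdd n)) _).symm).trans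
      (finsum_comp_equiv (Γ.pathsToEquiv f x.obj n) (f := g))

/-- A Cuntz-Krieger family of the pullback along a surjection descends to one of `Γ` if, up to a
character, it does not depend on the degrees. -/
theorem IsCuntzKriegerFamily.untwist (hf : Function.Surjective f)
    {t : ∀ {a b : (Γ.pullback f).Obj}, (a ⟶ b) → B}
    (ht : (Γ.pullback f).IsCuntzKriegerFamily t) (ω : Multiplicative Q →* Circle)
    {u : ∀ {a b : Γ.Obj}, (a ⟶ b) → B}
    (hu : ∀ {a b : Γ.Obj} (ξ : a ⟶ b) (n : Q) (h : Γ.deg ξ = f n),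
      u ξ = (((ω (.ofAdd n))⁻¹ : Circle) : ℂ) • t (Γ.pair f ξ n h)) :
    Γ.IsCuntzKriegerFamily u := by
  -- Of all the lifts of the degree of an identity, `0` is the one at which the scalar is `1`.
  have h1 : ∀ x : Γ.Obj, u (𝟙 x) = t (𝟙 (⟨x⟩ : (Γ.pullback f).Obj)) := by
    intro x
    rw [hu (𝟙 x) 0 (by rw [Γ.deg_id, map_zero]), ofAdd_zero, map_one, inv_one, Circle.coe_one,
      one_smul]
    rfl
  refine ⟨fun x => ?_, fun x y h => ?_, fun ζ η => ?_, fun ξ => ?_, fun x p => ?_⟩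
  · rw [h1]
    exact ht.projection _
  · rw [h1, h1]
    exact ht.orthogonal _ _ fun h' => h (congrArg PullbackObj.obj h')
  -- If `m` and `n` lift the degrees of the factors, then `n + m` lifts that of the composite.
  -- Independence of the lift allows `u (ζ ≫ η)` to be computed at `n + m`, where (CK2) for `t`
  -- applies.
  · obtain ⟨m, hm⟩ := hf (Γ.deg ζ)
    obtain ⟨n, hn⟩ := hf (Γ.deg η)
    rw [hu ζ m hm.symm, hu η n hn.symm,
      hu (ζ ≫ η) (n + m) (by rw [Γ.deg_comp, map_add, hm, hn]), smul_mul_smul_comm,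
      ofAdd_add, map_mul, mul_inv, Circle.coe_mul]
    exact congrArg _ (ht.mul (Γ.pair f ζ m hm.symm) (Γ.pair f η n hn.symm))
  · obtain ⟨n, hn⟩ := hf (Γ.deg ξ)
    rw [h1, hu ξ n hn.symm, circle_star_mul_smul]
    exact ht.star_mul_self (Γ.pair f ξ n hn.symm)
  -- Surjectivity of `f` is essential here: (CK4) for `t` only reaches degrees of the form `f n`.
  · obtain ⟨n, rfl⟩ := hf p
    refine (h1 x).trans ((ht.sum_eq _ n).trans
      ((finsum_comp_equiv (Γ.pathsToEquiv f x n)).symm.trans (finsum_congr fun ξ => ?_)))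
    rw [hu ξ.1.2 n ξ.2, circle_smul_mul_star]
    rfl

end Pullback

end PGraph

/-! ### The isomorphism -/

/-- The character `n ↦ z^n` of `ℕ^k`. -/
noncomputable def torusCharacter {k : ℕ} (z : Fin k → Circle) : Multiplicative (Fin k → ℕ) →* Circle where
  toFun n := torusPow z n.toAdd
  map_one' := by simp [torusPow]
  map_mul' m n := by simp [torusPow, pow_add, Finset.prod_mul_distrib]

theorem mainTheorem9 {k : ℕ} (H : AddSubgroup (Fin k → ℤ)) (Γ : PGraph.{u, v, 0} (imageMonoid H))
    [Γ.RowFiniteNoSources] (z : Fin k → Circle) :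
    ∃ ψ : (pullbackIdeal H Γ z).Quotient ≃⋆ₐ[ℂ] Γ.CStar,
      ∀ (a b : Γ.Obj) (ξ : a ⟶ b) (n : Fin k → ℕ) (h : Γ.deg ξ = degreeMap H n),
        ψ (CStarIdeal.Quotient.mk (pullbackIdeal H Γ z) (Γ.sPullback (degreeMap H) ξ n h)) =
          ((torusPow z n : Circle) : ℂ) • Γ.s ξ := by
  have hf : Function.Surjective (degreeMap H) := (quotientOnNat H).mrangeRestrict_surjective
  set I := pullbackIdeal H Γ z with hI
  set π := CStarIdeal.Quotient.mk I
  have hinv : ∀ (c : Circle) {E : Type (max u v)} [NonUnitalCStarAlgebra E] (x : E),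
      ((c⁻¹ : Circle) : ℂ) • ((c : Circle) : ℂ) • x = x := fun c E _ x => by
    rw [smul_smul, ← Circle.coe_mul, inv_mul_cancel, Circle.coe_one, one_smul]
  have hinv' : ∀ (c : Circle) {E : Type (max u v)} [NonUnitalCStarAlgebra E] (x : E),
      ((c : Circle) : ℂ) • ((c⁻¹ : Circle) : ℂ) • x = x := fun c E _ x => by
    rw [smul_smul, ← Circle.coe_mul, mul_inv_cancel, Circle.coe_one, one_smul]
  obtain ⟨φ, hφ, -⟩ := (Γ.pullback (degreeMap H)).existsUnique_hom _
    (Γ.isCuntzKriegerFamily_s.twist (f := degreeMap H) (torusCharacter z))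
  have hφs : ∀ {a b : Γ.Obj} (ξ : a ⟶ b) (n : Fin k → ℕ) (h : Γ.deg ξ = degreeMap H n),
      φ (Γ.sPullback (degreeMap H) ξ n h) = ((torusPow z n : Circle) : ℂ) • Γ.s ξ :=
    fun ξ n h => hφ (Γ.pair (degreeMap H) ξ n h)
  have hker : ∀ x ∈ I, φ x = 0 := fun x hx => by
    -- The kernel of `φ` is a closed ideal, so only the generators of $I_z$ have to be tested; both
    -- terms of such a generator are sent to `Γ.s ξ`.
    refine CStarIdeal.span_le (J := CStarIdeal.ker φ) ?_ hx
    rintro _ ⟨a, b, ξ, n₁, n₂, h₁, h₂, rfl⟩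
    change φ _ = 0
    rw [map_sub, map_smul, map_smul, hφs, hφs, hinv, hinv, sub_self]
  obtain ⟨ψ, hψ⟩ := CStarIdeal.Quotient.exists_lift φ hker
  -- The inverse has to send $s_\xi$ to the class of $z^{-n}s_{(\xi,n)}$ for a lift `n` of the
  -- degree. One lift is chosen here; by `hu` any other gives the same class, the difference being a
  -- generator of $I_z$.
  let u : ∀ {a b : Γ.Obj}, (a ⟶ b) → I.Quotient := fun {a b} ξ =>
    (((torusPow z (Function.surjInv hf (Γ.deg ξ)))⁻¹ : Circle) : ℂ) •
      π (Γ.sPullback (degreeMap H) ξ _ (Function.surjInv_eq hf (Γ.deg ξ)).symm)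
  have hu : ∀ {a b : Γ.Obj} (ξ : a ⟶ b) (n : Fin k → ℕ) (h : Γ.deg ξ = degreeMap H n),
      u ξ = (((torusPow z n)⁻¹ : Circle) : ℂ) • π (Γ.sPullback (degreeMap H) ξ n h) := by
    intro a b ξ n h
    simp only [u, ← map_smul]
    exact CStarIdeal.Quotient.mk_eq_mk.mpr
      (CStarIdeal.subset_span _ ⟨a, b, ξ, _, n, _, h, rfl⟩)
  have hπ : (Γ.pullback (degreeMap H)).IsCuntzKriegerFamily
      (fun {a b} (ξ : a ⟶ b) => π ((Γ.pullback (degreeMap H)).s ξ)) :=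
    (Γ.pullback (degreeMap H)).isCuntzKriegerFamily_s.map π
  obtain ⟨χ, hχ, -⟩ := Γ.existsUnique_hom u (hπ.untwist hf (torusCharacter z) hu)
  have hψχ : ψ.comp χ = NonUnitalStarAlgHom.id ℂ Γ.CStar := by
    refine (Γ.existsUnique_hom Γ.s Γ.isCuntzKriegerFamily_s).unique (fun ξ => ?_) fun ξ => rfl
    obtain ⟨n, hn⟩ := hf (Γ.deg ξ)
    rw [NonUnitalStarAlgHom.comp_apply, hχ, hu ξ n hn.symm, map_smul, hψ, hφs, hinv]
  -- The uniqueness statement available is that of $C^*(f^*\Gamma)$, not of its quotient, so the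
  -- maps are compared after composition with `π`, and surjectivity of `π` removes it afterwards.
  have hχψ : (χ.comp ψ).comp π = π := by
    refine ((Γ.pullback (degreeMap H)).existsUnique_hom _ hπ).unique (fun {a b} ξ => ?_)
      fun ξ => rfl
    rw [NonUnitalStarAlgHom.comp_apply, NonUnitalStarAlgHom.comp_apply, hψ, hφ, map_smul, hχ,
      hu (PGraph.PullbackHom.path ξ) (PGraph.PullbackHom.val ξ) (PGraph.PullbackHom.deg_eq ξ)]
    exact hinv' _ _
  have hright : ∀ x, ψ (χ x) = x := DFunLike.congr_fun hψχ
  have hleft : ∀ q, χ (ψ q) = q := fun q => by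
    obtain ⟨x, rfl⟩ := CStarIdeal.Quotient.mk_surjective q
    exact DFunLike.congr_fun hχψ x
  refine ⟨StarAlgEquiv.ofBijective ψ ⟨Function.LeftInverse.injective hleft,
    Function.RightInverse.surjective hright⟩, fun a b ξ n h => ?_⟩
  exact (hψ _).trans (hφs ξ n h)
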